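/- **Setting.** Packets are generated at a node at times $t_1<t_2<\dots$, where $t_1,\ t_2-t_1,\ t_3-t_2,\dots$ are i.i.d. exponential with rate $q>0$ (Poisson arrivals). A transmission schedule decides for each packet $n$ whether it is transmitted to the monitor and, if so, at which time $r_n\ge t_n$; transmission is instantaneous. Let $R(t)$ be the number of packets transmitted until time $t$, let $\lambda(t)$ be the largest generation time of a packet received until time $t$ ($\lambda(t)=0$ if there is none), and let $\Delta(t)=t-\lambda(t)$ be the age of information. For constants $\rho,c\ge 0$ the cost of a schedule is $$\Gamma=\lim_{t\to\infty}\Big(\rho\,\frac{c}{t}R(t)+\frac1t\int_0^t\Delta(s)\,ds\Big),$$ with $\liminf$ in place of $\lim$ if the limit does not exist. For a given sequence of generation times, $\Gamma_{\mathrm{OFF}}$ denotes the infimum of $\Gamma$ over all schedules; these may be chosen with knowledge of the whole sequence in advance. The threshold policy $\pi^*_{\mathrm{ON}}$ transmits a packet immediately at its generation if the time elapsed since its last transmission (since time $0$ if there was none) exceeds $T^*_{q,\rho c}=\sqrt{1/q^2+2\rho c}-1/q$, and never transmits it otherwise; $\Gamma_{\mathrm{ON}}$ is its cost. The competitive ratio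 $CR=CR(q,\rho,c)$ of $\pi^*_{\mathrm{ON}}$ is the essential supremum of $\Gamma_{\mathrm{ON}}/\Gamma_{\mathrm{OFF}}$ over the random sequence of generation times. **Theorem.** For all $q>0$ and $\rho,c\ge 0$, almost surely the limit defining $\Gamma_{\mathrm{ON}}$ exists and is finite and $\Gamma_{\mathrm{OFF}}>0$, and $$CR\le\sqrt2 .$$ Moreover $CR\to 1$ as $q^2\rho c\to\infty$ (uniformly in all $q>0$ and $\rho,c\ge0$ with the given value of $q^2\rho c$). -/

import Mathlib

open MeasureTheory ProbabilityTheory Filter Topology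
open scoped ENNReal

namespace AgeInfo

/-- Generation time of packet `n` (packets are numbered `0, 1, 2, …`), when the successive
inter-generation times are `x 0, x 1, x 2, …`, the first one counted from time `0`. -/
noncomputable def genTime (x : ℕ → ℝ) (n : ℕ) : ℝ := ∑ i ∈ Finset.range (n + 1), x i

/-- A transmission schedule: `r n` is the time at which packet `n` is transmitted (and, without
delay, received), and `r n = ⊤` if packet `n` is never transmitted. -/
abbrev Schedule : Type := ℕ → WithTop ℝ

/-- No packet is transmitted before it is generated. -/
def Schedule.Admissible (x : ℕ → ℝ) (r : Schedule) : Prop :=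
  ∀ n, (genTime x n : WithTop ℝ) ≤ r n

/-- `R(t)`: the number of packets transmitted until time `t`. -/
noncomputable def numSent (r : Schedule) (t : ℝ) : ℕ := {n | r n ≤ (t : WithTop ℝ)}.ncard

/-- `λ(t)`: generation time of the latest packet received until time `t`; it is `0` as long as
nothing has been received, so that the age starts from `0` at time `0`. -/
noncomputable def lastReceived (x : ℕ → ℝ) (r : Schedule) (t : ℝ) : ℝ :=
  sSup (insert 0 (genTime x '' {n | r n ≤ (t : WithTop ℝ)}))

/-- Age of information `Δ(t) = t - λ(t)`. -/
noncomputable def age (x : ℕ → ℝ) (r : Schedule) (t : ℝ) : ℝ := t - lastReceived x r t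

/-- `Δ_av(t)`: average age until time `t`. -/
noncomputable def avgAge (x : ℕ → ℝ) (r : Schedule) (t : ℝ) : ℝ :=
  (1 / t) * ∫ s in (0 : ℝ)..t, age x r s

/-- `C_av(t)`: average transmission cost until time `t`, at cost `c` per transmission. -/
noncomputable def avgTxCost (c : ℝ) (r : Schedule) (t : ℝ) : ℝ := (c / t) * numSent r t

/-- `ρ C_av(t) + Δ_av(t)`. -/
noncomputable def avgCost (ρ c : ℝ) (x : ℕ → ℝ) (r : Schedule) (t : ℝ) : ℝ :=
  ρ * avgTxCost c r t + avgAge x r t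

/-- The long-run average cost `Γ` of a schedule: the limit of `ρ C_av(t) + Δ_av(t)` as `t → ∞`
wherever it exists, and the lower limit otherwise (the choice most favourable to the schedule). -/
noncomputable def longRunCost (ρ c : ℝ) (x : ℕ → ℝ) (r : Schedule) : ℝ≥0∞ :=
  liminf (fun t : ℝ => ENNReal.ofReal (avgCost ρ c x r t)) atTop

/-- The optimal offline cost for the input `x`: the whole sequence of generation times is known in
advance, so any admissible schedule may be used. -/
noncomputable def offlineCost (ρ c : ℝ) (x : ℕ → ℝ) : ℝ≥0∞ :=
  ⨅ (r : Schedule) (_ : r.Admissible x), longRunCost ρ c x r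

/-- Start of the cycle in progress just before packet `n` is generated, under the policy that
transmits a packet at its generation if and only if more than `θ` time units have elapsed since
the start of the cycle in progress. -/
noncomputable def cycleStart (θ : ℝ) (x : ℕ → ℝ) : ℕ → ℝ
  | 0 => 0
  | n + 1 => if θ < genTime x n - cycleStart θ x n then genTime x n else cycleStart θ x n

/-- The threshold policy with threshold `θ`, as a map from inputs to schedules. -/
noncomputable def thresholdPolicy (θ : ℝ) (x : ℕ → ℝ) : Schedule := fun n =>
  if θ < genTime x n - cycleStart θ x n then (genTime x n : WithTop ℝ) else ⊤

/-- The threshold `√(1/q² + 2ρc) - 1/q`. -/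
noncomputable def optThreshold (q ρ c : ℝ) : ℝ := √(1 / q ^ 2 + 2 * (ρ * c)) - 1 / q

/-- The policy `π*_ON`. -/
noncomputable def onlinePolicy (q ρ c : ℝ) : (ℕ → ℝ) → Schedule :=
  thresholdPolicy (optThreshold q ρ c)

/-- Poisson arrivals of rate `q`: the law of an i.i.d. sequence of inter-generation times that are
exponentially distributed with rate `q`. -/
noncomputable def poissonInput (q : ℝ) : Measure (ℕ → ℝ) :=
  Measure.infinitePi fun _ : ℕ => expMeasure q

/-- The competitive ratio of a policy (a map from inputs to schedules) for inputs with law `μ`: the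
largest ratio of its cost to the optimal offline cost, over all inputs up to a `μ`-null set. -/
noncomputable def competitiveRatio (μ : Measure (ℕ → ℝ)) (ρ c : ℝ)
    (policy : (ℕ → ℝ) → Schedule) : ℝ≥0∞ :=
  essSup (fun x => longRunCost ρ c x (policy x) / offlineCost ρ c x) μ

end AgeInfo

namespace AgeInfo

/-! ### The exponential law -/

/-! Put β = ρc. Almost surely the online cost converges to √(1/q² + 2β), while every admissible
schedule costs at least 1/q and at least √(2β). Since a² + b² ≤ 2 max(a, b)², the ratio is at most
√2. The bound √(2β) alone gives √(1 + 1/(2q²β)), which tends to 1, and the ratio is at least 1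
because the online policy is itself admissible.

Offline bounds. The age is never less than the time since the latest arrival, so its average is
asymptotically at least (∑ xᵢ²/2)/∑ xᵢ → 1/q (`inv_le_longRunCost`). Moreover, a transmission pushes
the integral of the age below γt by at most γ²/2; for γ = √(2β) this is exactly its price β
(`sqrt_le_longRunCost`).

Online cost. The threshold θ solves β = θ²/2 + θ/q. At this price the cost up to an arrival is (θ +
1/q) times the elapsed time, plus a sum of deviations, minus a bounded term
(`cost_thresholdPolicy_decomposition`). A deviation is e²/2 - e/q, where e is the overshoot over the
threshold; as the exponential law has no memory, it has conditional mean zero given the past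
(`integral_sum_mul_deviation`). So the deviations are orthogonal to their past and bounded in L²,
and a strong law (`ae_tendsto_sum_div_of_orthogonal`) makes their average vanish. -/

lemma expMeasure_eq_withDensity (q : ℝ) :
    expMeasure q = (volume.restrict (Set.Ioi 0)).withDensity
      (fun x => ENNReal.ofReal (q * Real.exp (-(q * x)))) := by
  rw [← withDensity_indicator measurableSet_Ioi]
  refine withDensity_congr_ae ?_
  have h0 : ∀ᵐ x : ℝ, x ≠ 0 := by simp [ae_iff]
  filter_upwards [h0] with x hx
  change exponentialPDF q x = _
  rcases lt_or_gt_of_ne hx with h | h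
  · rw [exponentialPDF_of_neg h, Set.indicator_of_notMem (by simpa using h.le)]
  · rw [exponentialPDF_of_nonneg h.le, Set.indicator_of_mem (by simpa using h)]

lemma expMeasure_ae_pos (q : ℝ) : ∀ᵐ x ∂(expMeasure q), 0 < x := by
  rw [expMeasure_eq_withDensity]
  exact (withDensity_absolutelyContinuous _ _).ae_le (ae_restrict_mem measurableSet_Ioi)

lemma integral_expMeasure {q : ℝ} (hq : 0 < q) (f : ℝ → ℝ) :
    ∫ x, f x ∂(expMeasure q) = ∫ x in Set.Ioi 0, q * Real.exp (-(q * x)) * f x := by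
  rw [expMeasure_eq_withDensity, integral_withDensity_eq_integral_toReal_smul (by fun_prop)
    (by simp)]
  refine integral_congr_ae (Eventually.of_forall fun x => ?_)
  simp only [smul_eq_mul]
  rw [ENNReal.toReal_ofReal (by positivity)]

lemma integrable_expMeasure_iff {q : ℝ} (hq : 0 < q) {f : ℝ → ℝ} :
    Integrable f (expMeasure q) ↔
      IntegrableOn (fun x => q * Real.exp (-(q * x)) * f x) (Set.Ioi 0) := by
  rw [expMeasure_eq_withDensity, integrable_withDensity_iff_integrable_smul' (by fun_prop)
    (by simp)]
  refine integrable_congr (Eventually.of_forall fun x => ?_)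
  simp only [smul_eq_mul]
  rw [ENNReal.toReal_ofReal (by positivity)]

lemma integrable_pow_expMeasure {q : ℝ} (hq : 0 < q) (k : ℕ) :
    Integrable (fun x : ℝ => x ^ k) (expMeasure q) := by
  rw [integrable_expMeasure_iff hq]
  have h := (integrableOn_rpow_mul_exp_neg_mul_rpow (p := 1) (s := k) (b := q)
    (by have : (0 : ℝ) ≤ k := k.cast_nonneg
        linarith) one_pos hq).const_mul q
  refine h.congr (Eventually.of_forall fun x => ?_)
  simp only [Real.rpow_natCast, Real.rpow_one, neg_mul]
  ring

lemma integral_pow_expMeasure {q : ℝ} (hq : 0 < q) (k : ℕ) :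
    ∫ x, x ^ k ∂(expMeasure q) = k.factorial / q ^ k := by
  rw [integral_expMeasure hq]
  have h := Real.integral_rpow_mul_exp_neg_mul_Ioi (a := k + 1) (r := q) (by positivity) hq
  rw [Real.Gamma_nat_eq_factorial] at h
  simp only [add_sub_cancel_right, Real.rpow_natCast] at h
  have h2 : ∀ x : ℝ, q * Real.exp (-(q * x)) * x ^ k = q * (x ^ k * Real.exp (-(q * x))) :=
    fun x => by ring
  simp only [h2]
  rw [integral_const_mul, h]
  have : ((k : ℝ) + 1) = ((k + 1 : ℕ) : ℝ) := by push_cast; ring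
  rw [this, Real.rpow_natCast, one_div, inv_pow, pow_succ]
  field_simp

/-- The difference between the cost of a cycle of the threshold policy and its mean, when the cycle
exceeds the threshold by `e`. -/
noncomputable def overshootCost (q e : ℝ) : ℝ := e ^ 2 / 2 - e / q

lemma integral_overshootCost {q : ℝ} (hq : 0 < q) :
    ∫ x, overshootCost q x ∂(expMeasure q) = 0 := by
  have h1 := integral_pow_expMeasure hq 1
  have h2 := integral_pow_expMeasure hq 2
  have i1 := integrable_pow_expMeasure hq 1
  have i2 := integrable_pow_expMeasure hq 2
  simp only [pow_one] at h1 i1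
  unfold overshootCost
  rw [integral_sub (i2.div_const _) (i1.div_const _), integral_div, integral_div, h1, h2]
  simp
  field_simp
  simp

/-- The exponential law has no memory: the overshoot over a level `u ≥ 0`, if there is one, is again
exponential. -/
lemma integral_overshootCost_max {q u : ℝ} (hq : 0 < q) (hu : 0 ≤ u) :
    ∫ x, overshootCost q (max (x - u) 0) ∂(expMeasure q) = 0 := by
  have h0 := integral_overshootCost hq
  rw [integral_expMeasure hq] at h0 ⊢
  -- Extension by zero turns the shift by `u` into a translation on the whole line; the density
  -- contributes the constant factor exp(-qu).
  set g : ℝ → ℝ := (Set.Ioi 0).indicator fun y => q * Real.exp (-(q * y)) * overshootCost q y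
    with hg
  have h1 : ∀ x ∈ Set.Ioi (0 : ℝ),
      q * Real.exp (-(q * x)) * overshootCost q (max (x - u) 0)
        = Real.exp (-(q * u)) * g (x - u) := by
    intro x _
    by_cases hx : u < x
    · rw [hg, Set.indicator_of_mem (by simpa using hx), max_eq_left (by linarith),
        show -(q * x) = -(q * u) + -(q * (x - u)) by ring, Real.exp_add]
      ring
    · rw [hg, Set.indicator_of_notMem (by simpa using hx), max_eq_right (by linarith)]
      simp [overshootCost]
  have h2 : ∀ x, x ∉ Set.Ioi (0 : ℝ) → Real.exp (-(q * u)) * g (x - u) = 0 := by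
    intro x hx
    rw [hg, Set.indicator_of_notMem, mul_zero]
    simp only [Set.mem_Ioi, not_lt] at hx ⊢
    linarith
  rw [setIntegral_congr_fun measurableSet_Ioi h1, setIntegral_eq_integral_of_forall_compl_eq_zero h2,
    integral_const_mul, integral_sub_right_eq_self g u, hg, integral_indicator measurableSet_Ioi, h0,
    mul_zero]

/-- Completing the square. The uniform lower bound is what the strong law below needs to interpolate
between the times of a subsequence. -/
lemma neg_le_overshootCost {q : ℝ} (hq : 0 < q) (e : ℝ) :
    -(1 / (2 * q ^ 2)) ≤ overshootCost q e := by
  have : overshootCost q e + 1 / (2 * q ^ 2) = (e - 1 / q) ^ 2 / 2 := by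
    unfold overshootCost
    field_simp
    ring
  nlinarith [sq_nonneg (e - 1 / q)]

lemma abs_overshootCost_max_le {q u x : ℝ} (hq : 0 < q) (hu : 0 ≤ u) (hx : 0 ≤ x) :
    |overshootCost q (max (x - u) 0)| ≤ x ^ 2 / 2 + x / q := by
  set e := max (x - u) 0
  have he : 0 ≤ e := le_max_right _ _
  have hex : e ≤ x := max_le (by linarith) hx
  have h1 : e ^ 2 ≤ x ^ 2 := by gcongr
  have h2 : e / q ≤ x / q := by gcongr
  have h3 : 0 ≤ e / q := by positivity
  have h4 := sq_nonneg e
  unfold overshootCost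
  rw [abs_le]
  constructor <;> linarith

/-! ### The input process -/

/-- `arrival x n` is the sum of the first `n` inter-generation times. -/
noncomputable def arrival (x : ℕ → ℝ) (n : ℕ) : ℝ := ∑ i ∈ Finset.range n, x i

lemma genTime_eq_arrival (x : ℕ → ℝ) (n : ℕ) : genTime x n = arrival x (n + 1) := rfl

@[simp] lemma arrival_zero (x : ℕ → ℝ) : arrival x 0 = 0 := by simp [arrival]

lemma arrival_succ (x : ℕ → ℝ) (n : ℕ) : arrival x (n + 1) = arrival x n + x n :=
  Finset.sum_range_succ _ _

/-- Time elapsed in the current cycle of the threshold policy after `n` arrivals. -/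
noncomputable def elapsed (θ : ℝ) (x : ℕ → ℝ) (n : ℕ) : ℝ := arrival x n - cycleStart θ x n

@[simp] lemma elapsed_zero (θ : ℝ) (x : ℕ → ℝ) : elapsed θ x 0 = 0 := by
  simp [elapsed, cycleStart]

lemma genTime_sub_cycleStart (θ : ℝ) (x : ℕ → ℝ) (n : ℕ) :
    genTime x n - cycleStart θ x n = elapsed θ x n + x n := by
  rw [genTime_eq_arrival, arrival_succ, elapsed]
  ring

lemma elapsed_succ (θ : ℝ) (x : ℕ → ℝ) (n : ℕ) :
    elapsed θ x (n + 1) = if θ < elapsed θ x n + x n then 0 else elapsed θ x n + x n := by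
  rw [elapsed, cycleStart, genTime_sub_cycleStart]
  split_ifs
  · rw [genTime_eq_arrival, sub_self]
  · rw [elapsed, arrival_succ]; ring

lemma elapsed_le {θ : ℝ} (hθ : 0 ≤ θ) (x : ℕ → ℝ) (n : ℕ) : elapsed θ x n ≤ θ := by
  cases n with
  | zero => simpa using hθ
  | succ n => rw [elapsed_succ]; split_ifs <;> linarith

lemma elapsed_nonneg (θ : ℝ) {x : ℕ → ℝ} (hx : ∀ i, 0 < x i) (n : ℕ) : 0 ≤ elapsed θ x n := by
  induction n with
  | zero => simp
  | succ n ih =>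
    rw [elapsed_succ]
    split_ifs
    · rfl
    · linarith [hx n]

lemma measurable_elapsed (θ : ℝ) (n : ℕ) : Measurable fun x => elapsed θ x n := by
  induction n with
  | zero => simp
  | succ n ih =>
    simp only [elapsed_succ]
    have h : Measurable fun x : ℕ → ℝ => elapsed θ x n + x n := ih.add (measurable_pi_apply n)
    exact Measurable.ite (measurableSet_lt measurable_const h) measurable_const h

/-- The policy is causal, which later yields independence of `elapsed θ x n` and `x n`. -/
lemma elapsed_congr (θ : ℝ) {x y : ℕ → ℝ} {n : ℕ} (h : ∀ i < n, x i = y i) :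
    elapsed θ x n = elapsed θ y n := by
  induction n with
  | zero => simp
  | succ n ih =>
    rw [elapsed_succ, elapsed_succ, ih fun i hi => h i (by lia), h n (by lia)]

/-- Deviation of the cost from its mean that arises with packet `n`. -/
noncomputable def deviation (q θ : ℝ) (x : ℕ → ℝ) (n : ℕ) : ℝ :=
  overshootCost q (max (x n - (θ - elapsed θ x n)) 0)

lemma measurable_overshootCost (q : ℝ) : Measurable (overshootCost q) := by
  unfold overshootCost
  fun_prop

lemma measurable_deviation (q θ : ℝ) (n : ℕ) : Measurable fun x => deviation q θ x n := by
  have h := measurable_elapsed θ n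
  exact (measurable_overshootCost q).comp
    (((measurable_pi_apply n).sub (measurable_const.sub h)).max measurable_const)

lemma deviation_congr (q θ : ℝ) {x y : ℕ → ℝ} {n : ℕ} (h : ∀ i ≤ n, x i = y i) :
    deviation q θ x n = deviation q θ y n := by
  rw [deviation, deviation, h n le_rfl, elapsed_congr θ fun i hi => h i hi.le]

lemma abs_deviation_le {q θ : ℝ} (hq : 0 < q) (hθ : 0 ≤ θ) {x : ℕ → ℝ} {n : ℕ} (hx : 0 < x n) :
    |deviation q θ x n| ≤ x n ^ 2 / 2 + x n / q :=
  abs_overshootCost_max_le hq (sub_nonneg.2 (elapsed_le hθ x n)) hx.le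

/-! ### A strong law of large numbers for orthogonal increments -/

section OrthogonalIncrements

variable {Ω : Type*} {mΩ : MeasurableSpace Ω} {μ : Measure Ω}

/-- Pythagoras: the cross terms vanish by orthogonality, so second moments add up. -/
lemma integral_sq_sum_le {D : ℕ → Ω → ℝ} {C : ℝ} (hD : ∀ n, MemLp (D n) 2 μ)
    (horth : ∀ n, ∫ ω, (∑ k ∈ Finset.range n, D k ω) * D n ω ∂μ = 0)
    (hC : ∀ n, ∫ ω, D n ω ^ 2 ∂μ ≤ C) (n : ℕ) :
    ∫ ω, (∑ k ∈ Finset.range n, D k ω) ^ 2 ∂μ ≤ n * C := by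
  have hS : ∀ n, MemLp (fun ω => ∑ k ∈ Finset.range n, D k ω) 2 μ := fun n =>
    memLp_finsetSum _ fun k _ => hD k
  induction n with
  | zero => simp
  | succ n ih =>
    have e : ∀ ω, (∑ k ∈ Finset.range (n + 1), D k ω) ^ 2
        = (∑ k ∈ Finset.range n, D k ω) ^ 2
          + (2 * ((∑ k ∈ Finset.range n, D k ω) * D n ω) + D n ω ^ 2) := fun ω => by
      rw [Finset.sum_range_succ]; ring
    have i1 : Integrable (fun ω => (∑ k ∈ Finset.range n, D k ω) * D n ω) μ :=
      (hS n).integrable_mul (hD n)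
    simp only [e]
    have i2 : Integrable (fun ω => 2 * ((∑ k ∈ Finset.range n, D k ω) * D n ω) + D n ω ^ 2) μ :=
      (i1.const_mul 2).add (hD n).integrable_sq
    rw [integral_add (hS n).integrable_sq i2, integral_add (i1.const_mul 2) (hD n).integrable_sq, integral_const_mul, horth]
    push_cast
    linarith [hC n]

/-- Because ⌊aⁿ⌋ > aⁿ/2, the average at time ⌊aⁿ⌋ has second moment at most 2C a⁻ⁿ. These moments
are summable, so the squared averages are almost surely summable and tend to zero. -/
lemma ae_tendsto_sum_floor_pow_div {D : ℕ → Ω → ℝ} {C a : ℝ} (ha : 1 < a)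
    (hD : ∀ n, MemLp (D n) 2 μ)
    (horth : ∀ n, ∫ ω, (∑ k ∈ Finset.range n, D k ω) * D n ω ∂μ = 0)
    (hC : ∀ n, ∫ ω, D n ω ^ 2 ∂μ ≤ C) :
    ∀ᵐ ω ∂μ, Tendsto (fun n : ℕ => (∑ k ∈ Finset.range ⌊a ^ n⌋₊, D k ω) / (⌊a ^ n⌋₊ : ℝ))
      atTop (𝓝 0) := by
  have hC0 : 0 ≤ C := (integral_nonneg fun ω => sq_nonneg _).trans (hC 0)
  have hS : ∀ n, MemLp (fun ω => ∑ k ∈ Finset.range n, D k ω) 2 μ := fun n =>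
    memLp_finsetSum _ fun k _ => hD k
  set Z : ℕ → Ω → ℝ := fun n ω => (∑ k ∈ Finset.range ⌊a ^ n⌋₊, D k ω) / (⌊a ^ n⌋₊ : ℝ) with hZ
  have hZ2 : ∀ n, MemLp (Z n) 2 μ := fun n => by
    simp only [hZ, div_eq_mul_inv]
    exact (hS _).mul_const _
  have hbound : ∀ n, ∫ ω, Z n ω ^ 2 ∂μ ≤ 2 * C * (a⁻¹) ^ n := by
    intro n
    have hpow : 1 ≤ a ^ n := one_le_pow₀ ha.le
    have hfl : a ^ n / 2 < (⌊a ^ n⌋₊ : ℝ) := Nat.div_two_lt_floor hpow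
    have hfl0 : (0 : ℝ) < (⌊a ^ n⌋₊ : ℝ) := by linarith
    simp only [hZ, div_pow]
    rw [integral_div, div_le_iff₀ (by positivity)]
    refine (integral_sq_sum_le hD horth hC _).trans ?_
    rw [inv_pow]
    have h1 : 1 ≤ 2 * (a ^ n)⁻¹ * (⌊a ^ n⌋₊ : ℝ) := by
      rw [mul_assoc, mul_comm ((a ^ n)⁻¹), ← div_eq_mul_inv, ← mul_div_assoc,
        le_div_iff₀ (by linarith)]
      linarith
    nlinarith [mul_le_mul_of_nonneg_left h1 (mul_nonneg hfl0.le hC0)]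
  have hsum : ∫⁻ ω, ∑' n, ENNReal.ofReal (Z n ω ^ 2) ∂μ ≠ ⊤ := by
    rw [lintegral_tsum fun n => ((hZ2 n).aestronglyMeasurable.aemeasurable.pow_const 2).ennreal_ofReal]
    have hle : ∀ n, ∫⁻ ω, ENNReal.ofReal (Z n ω ^ 2) ∂μ ≤ ENNReal.ofReal (2 * C * (a⁻¹) ^ n) := by
      intro n
      rw [← ofReal_integral_eq_lintegral_ofReal (hZ2 n).integrable_sq
        (Eventually.of_forall fun ω => sq_nonneg _)]
      exact ENNReal.ofReal_le_ofReal (hbound n)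
    refine ne_top_of_le_ne_top ?_ (ENNReal.tsum_le_tsum hle)
    exact ((summable_geometric_of_lt_one (by positivity)
      (inv_lt_one_of_one_lt₀ ha)).mul_left (2 * C)).tsum_ofReal_ne_top
  have hmeas : AEMeasurable (fun ω => ∑' n, ENNReal.ofReal (Z n ω ^ 2)) μ :=
    AEMeasurable.tsum fun n =>
      ((hZ2 n).aestronglyMeasurable.aemeasurable.pow_const 2).ennreal_ofReal
  filter_upwards [ae_lt_top' hmeas hsum] with ω hω
  have h := ENNReal.tendsto_atTop_zero_of_tsum_ne_top hω.ne
  have h2 : Tendsto (fun n => Z n ω ^ 2) atTop (𝓝 0) := by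
    have := (ENNReal.tendsto_toReal ENNReal.zero_ne_top).comp h
    refine this.congr fun n => ?_
    simp [ENNReal.toReal_ofReal (sq_nonneg _)]
  have h3 := h2.sqrt
  simp only [Real.sqrt_sq_eq_abs, Real.sqrt_zero] at h3
  exact (tendsto_zero_iff_abs_tendsto_zero _).2 h3

/-- The strong law of large numbers for increments that are bounded below and bounded in `L²`, each
of them orthogonal to the sum of its predecessors. -/
lemma ae_tendsto_sum_div_of_orthogonal {D : ℕ → Ω → ℝ} {C K : ℝ} (hD : ∀ n, MemLp (D n) 2 μ)
    (horth : ∀ n, ∫ ω, (∑ k ∈ Finset.range n, D k ω) * D n ω ∂μ = 0)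
    (hC : ∀ n, ∫ ω, D n ω ^ 2 ∂μ ≤ C) (hK : ∀ n ω, -K ≤ D n ω) :
    ∀ᵐ ω ∂μ, Tendsto (fun n : ℕ => (∑ k ∈ Finset.range n, D k ω) / n) atTop (𝓝 0) := by
  have hc : ∀ k : ℕ, (1 : ℝ) < 1 + 1 / ((k : ℝ) + 1) := fun k => by
    have : 0 < 1 / ((k : ℝ) + 1) := by positivity
    linarith
  have hclim : Tendsto (fun k : ℕ => 1 + 1 / ((k : ℝ) + 1)) atTop (𝓝 1) := by
    simpa using tendsto_one_div_add_atTop_nhds_zero_nat.const_add (1 : ℝ)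
  filter_upwards [ae_all_iff.2 fun k : ℕ => ae_tendsto_sum_floor_pow_div (hc k) hD horth hC]
    with ω hω
  -- Adding `K` makes the partial sums monotone, so convergence along ⌊aⁿ⌋, for a sequence of ratios
  -- a decreasing to 1, forces convergence along all n.
  set u : ℕ → ℝ := fun n => ∑ k ∈ Finset.range n, (D k ω + K) with hu
  have hue : ∀ n, u n = (∑ k ∈ Finset.range n, D k ω) + n * K := fun n => by
    simp [hu, Finset.sum_add_distrib]
  have hmono : Monotone u := monotone_nat_of_le_succ fun n => by
    simp only [hu, Finset.sum_range_succ]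
    linarith [hK n ω]
  have key : Tendsto (fun n : ℕ => u n / n) atTop (𝓝 K) := by
    refine tendsto_div_of_monotone_of_tendsto_div_floor_pow u K hmono _ hc hclim fun k => ?_
    have h := (hω k).add_const K
    rw [zero_add] at h
    refine h.congr fun n => ?_
    have hpow : (1 : ℝ) ≤ (1 + 1 / ((k : ℝ) + 1)) ^ n := one_le_pow₀ (hc k).le
    have hfl0 : (0 : ℝ) < (⌊(1 + 1 / ((k : ℝ) + 1)) ^ n⌋₊ : ℝ) := by
      have := Nat.div_two_lt_floor hpow
      linarith
    rw [hue, add_div, mul_div_cancel_left₀ _ hfl0.ne']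
  have h := key.sub_const K
  rw [sub_self] at h
  refine h.congr' ?_
  filter_upwards [eventually_gt_atTop 0] with n hn
  have : (0 : ℝ) < n := by exact_mod_cast hn
  rw [hue]
  field_simp
  ring

end OrthogonalIncrements

/-! ### Laws of large numbers for Poisson arrivals -/

section Poisson

variable {q : ℝ}

lemma isProbabilityMeasure_poissonInput (hq : 0 < q) : IsProbabilityMeasure (poissonInput q) := by
  have := isProbabilityMeasure_expMeasure hq
  unfold poissonInput
  infer_instance

lemma measurePreserving_poissonInput (hq : 0 < q) (n : ℕ) :
    MeasurePreserving (fun x : ℕ → ℝ => x n) (poissonInput q) (expMeasure q) := by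
  have := isProbabilityMeasure_expMeasure hq
  exact measurePreserving_eval_infinitePi (fun _ : ℕ => expMeasure q) n

lemma iIndepFun_poissonInput (hq : 0 < q) :
    iIndepFun (fun n (x : ℕ → ℝ) => x n) (poissonInput q) := by
  have := isProbabilityMeasure_expMeasure hq
  exact iIndepFun_infinitePi (P := fun _ : ℕ => expMeasure q) (X := fun _ x => x)
    fun _ => measurable_id

lemma poissonInput_ae_pos (hq : 0 < q) : ∀ᵐ x ∂(poissonInput q), ∀ n, 0 < x n :=
  ae_all_iff.2 fun n =>
    (measurePreserving_poissonInput hq n).quasiMeasurePreserving.ae (expMeasure_ae_pos q)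

lemma poissonInput_ae_tendsto_sum_pow (hq : 0 < q) (k : ℕ) :
    ∀ᵐ x ∂(poissonInput q), Tendsto (fun n : ℕ => (∑ i ∈ Finset.range n, x i ^ k) / (n : ℝ)) atTop
      (𝓝 (k.factorial / q ^ k)) := by
  have hm : Measurable fun y : ℝ => y ^ k := by fun_prop
  have hmp := measurePreserving_poissonInput hq
  have hint : Integrable (fun x : ℕ → ℝ => x 0 ^ k) (poissonInput q) :=
    (hmp 0).integrable_comp_of_integrable (integrable_pow_expMeasure hq k)
  have hval : ∫ x : ℕ → ℝ, x 0 ^ k ∂(poissonInput q) = k.factorial / q ^ k := by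
    rw [← integral_pow_expMeasure hq k, ← (hmp 0).map_eq,
      integral_map (hmp 0).aemeasurable hm.aestronglyMeasurable]
  have h := strong_law_ae_real (fun i (x : ℕ → ℝ) => x i ^ k) hint
    (fun i j hij => ((iIndepFun_poissonInput hq).indepFun hij).comp hm hm)
    (fun i => (IdentDistrib.mk (hmp i).aemeasurable (hmp 0).aemeasurable
      ((hmp i).map_eq.trans (hmp 0).map_eq.symm)).comp hm)
  rwa [hval] at h

lemma integrable_sq_deviation_bound (hq : 0 < q) :
    Integrable (fun y : ℝ => (y ^ 2 / 2 + y / q) ^ 2) (expMeasure q) := by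
  have h := (((integrable_pow_expMeasure hq 4).div_const 4).add
    ((integrable_pow_expMeasure hq 3).div_const q)).add
      ((integrable_pow_expMeasure hq 2).div_const (q ^ 2))
  refine h.congr (Eventually.of_forall fun y => ?_)
  simp only [Pi.add_apply]
  field_simp
  ring

lemma sq_deviation_le {θ : ℝ} (hq : 0 < q) (hθ : 0 ≤ θ) {x : ℕ → ℝ} {n : ℕ} (hx : 0 < x n) :
    deviation q θ x n ^ 2 ≤ (x n ^ 2 / 2 + x n / q) ^ 2 := by
  rw [← sq_abs]
  gcongr
  exact abs_deviation_le hq hθ hx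

lemma memLp_deviation {θ : ℝ} (hq : 0 < q) (hθ : 0 ≤ θ) (n : ℕ) :
    MemLp (fun x => deviation q θ x n) 2 (poissonInput q) := by
  have hm := (measurable_deviation q θ n).aestronglyMeasurable (μ := poissonInput q)
  rw [memLp_two_iff_integrable_sq hm]
  refine ((measurePreserving_poissonInput hq n).integrable_comp_of_integrable
    (integrable_sq_deviation_bound hq)).mono (hm.pow 2) ?_
  filter_upwards [poissonInput_ae_pos hq] with x hx
  simp only [Function.comp_apply, Real.norm_eq_abs]
  rw [abs_of_nonneg (sq_nonneg _), abs_of_nonneg (sq_nonneg _)]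
  exact sq_deviation_le hq hθ (hx n)

lemma integral_sq_deviation_le {θ : ℝ} (hq : 0 < q) (hθ : 0 ≤ θ) (n : ℕ) :
    ∫ x, deviation q θ x n ^ 2 ∂(poissonInput q)
      ≤ ∫ y, (y ^ 2 / 2 + y / q) ^ 2 ∂(expMeasure q) := by
  have hmp := measurePreserving_poissonInput hq n
  rw [← hmp.map_eq, integral_map hmp.aemeasurable (by fun_prop)]
  refine integral_mono_ae (memLp_deviation hq hθ n).integrable_sq
    (hmp.integrable_comp_of_integrable (integrable_sq_deviation_bound hq)) ?_
  filter_upwards [poissonInput_ae_pos hq] with x hx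
  exact sq_deviation_le hq hθ (hx n)

/-- A measurable function of the first `n` inter-generation times is independent of the next one. -/
lemma indepFun_past {β : Type*} [MeasurableSpace β] (hq : 0 < q) {n : ℕ} {Y : (ℕ → ℝ) → β}
    (hY : Measurable Y) (hpast : ∀ x y, (∀ i < n, x i = y i) → Y x = Y y) :
    IndepFun Y (fun x => x n) (poissonInput q) := by
  have h := (iIndepFun_poissonInput hq).indepFun_finset (Finset.range n) {n} (by simp)
    fun i => measurable_pi_apply i
  -- Padding the first `n` coordinates with zeros exhibits `Y` as a measurable function of them
  -- alone.
  let ext : (Finset.range n → ℝ) → ℕ → ℝ := fun z i =>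
    if hi : i ∈ Finset.range n then z ⟨i, hi⟩ else 0
  have hext : Measurable ext := measurable_pi_lambda _ fun i => by
    by_cases hi : i ∈ Finset.range n
    · simp only [ext, hi, dite_true]
      exact measurable_pi_apply _
    · simp only [ext, hi, dite_false]
      exact measurable_const
  have h2 := h.comp (hY.comp hext)
    (measurable_pi_apply (⟨n, Finset.mem_singleton_self n⟩ : ({n} : Finset ℕ)))
  refine h2.congr (Eventually.of_forall fun x => ?_) (Eventually.of_forall fun x => rfl)
  refine hpast _ _ fun i hi => ?_
  simp [ext, hi]

/-- Given the past, the level θ - `elapsed` still to be passed is a fixed nonnegative number and `x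
n` is a fresh exponential variable. By Fubini the inner integral vanishes through
`integral_overshootCost_max`. -/
lemma integral_sum_mul_deviation {θ : ℝ} (hq : 0 < q) (hθ : 0 ≤ θ) (n : ℕ) :
    ∫ x, (∑ k ∈ Finset.range n, deviation q θ x k) * deviation q θ x n ∂(poissonInput q) = 0 := by
  have := isProbabilityMeasure_poissonInput hq
  have := isProbabilityMeasure_expMeasure hq
  set Y : (ℕ → ℝ) → ℝ × ℝ := fun x => (∑ k ∈ Finset.range n, deviation q θ x k, elapsed θ x n)
    with hYdef
  have hY : Measurable Y :=
    (Finset.measurable_sum _ fun k _ => measurable_deviation q θ k).prodMk (measurable_elapsed θ n)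
  have hind : IndepFun Y (fun x => x n) (poissonInput q) := by
    refine indepFun_past hq hY fun x y hxy => ?_
    simp only [hYdef]
    rw [elapsed_congr θ hxy, Finset.sum_congr rfl fun k hk =>
      deviation_congr q θ fun i hi => hxy i (by have := Finset.mem_range.1 hk; lia)]
  have hmp := measurePreserving_poissonInput hq n
  have hpair : Measurable fun x : ℕ → ℝ => (Y x, x n) := hY.prodMk (measurable_pi_apply n)
  have hmap := (indepFun_iff_map_prod_eq_prod_map_map hY.aemeasurable hmp.aemeasurable).1 hind
  rw [hmp.map_eq] at hmap
  set g : (ℝ × ℝ) × ℝ → ℝ := fun p => p.1.1 * overshootCost q (max (p.2 - (θ - p.1.2)) 0)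
  have hg : Measurable g :=
    measurable_fst.fst.mul ((measurable_overshootCost q).comp (by fun_prop))
  have hint : Integrable (fun x => g (Y x, x n)) (poissonInput q) :=
    (memLp_finsetSum (Finset.range n) fun k _ => memLp_deviation hq hθ k).integrable_mul
      (memLp_deviation hq hθ n)
  have hintg : Integrable g (((poissonInput q).map Y).prod (expMeasure q)) := by
    rw [← hmap, integrable_map_measure hg.aestronglyMeasurable hpair.aemeasurable]
    exact hint
  calc _ = ∫ x, g (Y x, x n) ∂(poissonInput q) := rfl
    _ = ∫ p, g p ∂(((poissonInput q).map Y).prod (expMeasure q)) := by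
      rw [← hmap, integral_map hpair.aemeasurable hg.aestronglyMeasurable]
    _ = ∫ y, ∫ z, g (y, z) ∂(expMeasure q) ∂((poissonInput q).map Y) := integral_prod _ hintg
    _ = 0 := by
      refine integral_eq_zero_of_ae ?_
      have hset : MeasurableSet {y : ℝ × ℝ | y.2 ≤ θ} :=
        measurableSet_le measurable_snd measurable_const
      have hae : ∀ᵐ y ∂((poissonInput q).map Y), y.2 ≤ θ :=
        (ae_map_iff hY.aemeasurable hset).2 (Eventually.of_forall fun x => elapsed_le hθ x n)
      filter_upwards [hae] with y hy
      simp only [g, Pi.zero_apply]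
      rw [integral_const_mul, integral_overshootCost_max hq (sub_nonneg.2 hy), mul_zero]

lemma poissonInput_ae_tendsto_sum_deviation {θ : ℝ} (hq : 0 < q) (hθ : 0 ≤ θ) :
    ∀ᵐ x ∂(poissonInput q),
      Tendsto (fun n : ℕ => (∑ k ∈ Finset.range n, deviation q θ x k) / n) atTop (𝓝 0) :=
  ae_tendsto_sum_div_of_orthogonal (memLp_deviation hq hθ) (integral_sum_mul_deviation hq hθ)
    (integral_sq_deviation_le hq hθ) fun _ _ => neg_le_overshootCost hq _

end Poisson

/-! ### Arrival times -/

section Arrival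

variable {x : ℕ → ℝ}

lemma strictMono_arrival (hx : ∀ i, 0 < x i) : StrictMono (arrival x) :=
  strictMono_nat_of_lt_succ fun n => by rw [arrival_succ]; linarith [hx n]

lemma arrival_nonneg (hx : ∀ i, 0 < x i) (n : ℕ) : 0 ≤ arrival x n :=
  Finset.sum_nonneg fun i _ => (hx i).le

/-- The counting function `N` transfers limits along arrivals to limits in continuous time. -/
lemma exists_arrivalCount (hx : ∀ i, 0 < x i) (hT : Tendsto (arrival x) atTop atTop) :
    ∃ N : ℝ → ℕ, (∀ t, 0 ≤ t → arrival x (N t) ≤ t ∧ t < arrival x (N t + 1)) ∧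
      Tendsto N atTop atTop := by
  have hmono := strictMono_arrival hx
  have hex : ∀ t : ℝ, 0 ≤ t → ∃ n, arrival x n ≤ t ∧ t < arrival x (n + 1) := by
    intro t ht
    obtain ⟨m, hm⟩ := (hT.eventually_gt_atTop t).exists
    classical
    have hP : ∃ m, t < arrival x m := ⟨m, hm⟩
    obtain ⟨k, hk⟩ : ∃ k, Nat.find hP = k + 1 := by
      refine Nat.exists_eq_succ_of_ne_zero fun h0 => ?_
      have := Nat.find_spec hP
      rw [h0, arrival_zero] at this
      linarith
    refine ⟨k, not_lt.1 (Nat.find_min hP (by lia)), ?_⟩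
    rw [← hk]
    exact Nat.find_spec hP
  choose! N hN using hex
  refine ⟨N, hN, tendsto_atTop.2 fun k => ?_⟩
  filter_upwards [eventually_ge_atTop (arrival x k)] with t ht
  have h := (hN t ((arrival_nonneg hx k).trans ht)).2
  exact Nat.lt_succ_iff.1 (hmono.lt_iff_lt.1 (ht.trans_lt h))

end Arrival

/-! ### Admissible schedules -/

section Admissible

variable {x : ℕ → ℝ} {r : Schedule}

lemma Schedule.Admissible.genTime_le (hr : r.Admissible x) {n : ℕ} {t : ℝ}
    (h : r n ≤ (t : WithTop ℝ)) : genTime x n ≤ t :=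
  WithTop.coe_le_coe.1 ((hr n).trans h)

lemma Schedule.Admissible.finite_sent (hr : r.Admissible x)
    (hT : Tendsto (arrival x) atTop atTop) (t : ℝ) : {n | r n ≤ (t : WithTop ℝ)}.Finite := by
  obtain ⟨m, hm⟩ := ((hT.comp (tendsto_add_atTop_nat 1)).eventually_gt_atTop t).exists_forall_of_atTop
  refine (Set.finite_lt_nat m).subset fun n hn => ?_
  by_contra hmn
  have h1 : t < genTime x n := hm n (not_lt.1 hmn)
  exact absurd (hr.genTime_le hn) (not_le.2 h1)

lemma Schedule.Admissible.bddAbove_received (hr : r.Admissible x) (t : ℝ) :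
    BddAbove (insert 0 (genTime x '' {n | r n ≤ (t : WithTop ℝ)})) := by
  refine ⟨max 0 t, ?_⟩
  rintro _ (rfl | ⟨n, hn, rfl⟩)
  · exact le_max_left _ _
  · exact (hr.genTime_le hn).trans (le_max_right _ _)

lemma Schedule.Admissible.monotone_lastReceived (hr : r.Admissible x) :
    Monotone (lastReceived x r) := fun _ t hst =>
  csSup_le_csSup (hr.bddAbove_received t) (Set.insert_nonempty _ _)
    (Set.insert_subset_insert (Set.image_mono fun _ hn =>
      le_trans hn (WithTop.coe_le_coe.2 hst)))

lemma lastReceived_le {t b : ℝ} (hb : 0 ≤ b)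
    (h : ∀ n, r n ≤ (t : WithTop ℝ) → genTime x n ≤ b) : lastReceived x r t ≤ b := by
  refine csSup_le (Set.insert_nonempty _ _) ?_
  rintro _ (rfl | ⟨n, hn, rfl⟩)
  · exact hb
  · exact h n hn

lemma Schedule.Admissible.lastReceived_mem (hr : r.Admissible x)
    (hT : Tendsto (arrival x) atTop atTop) (t : ℝ) :
    lastReceived x r t ∈ insert 0 (genTime x '' {n | r n ≤ (t : WithTop ℝ)}) :=
  (Set.insert_nonempty _ _).csSup_mem (((hr.finite_sent hT t).image _).insert _)

lemma Schedule.Admissible.age_nonneg (hr : r.Admissible x) {t : ℝ} (ht : 0 ≤ t) :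
    0 ≤ age x r t :=
  sub_nonneg.2 (lastReceived_le ht fun _ hn => hr.genTime_le hn)

/-- Even a schedule that sends everything at once can have received nothing newer than the latest
arrival. -/
lemma Schedule.Admissible.sub_arrival_le_age (hr : r.Admissible x) (hx : ∀ i, 0 < x i) {n : ℕ}
    {t : ℝ} (ht : t < arrival x (n + 1)) : t - arrival x n ≤ age x r t := by
  refine sub_le_sub_left (lastReceived_le (arrival_nonneg hx n) fun m hm => ?_) t
  have h := (hr.genTime_le hm).trans_lt ht
  rw [genTime_eq_arrival, (strictMono_arrival hx).lt_iff_lt] at h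
  exact (strictMono_arrival hx).monotone (by lia)

lemma Schedule.Admissible.intervalIntegrable_age (hr : r.Admissible x) (a b : ℝ) :
    IntervalIntegrable (age x r) volume a b :=
  continuous_id.intervalIntegrable a b |>.sub hr.monotone_lastReceived.intervalIntegrable

lemma integral_sub_const_eq (a b v : ℝ) :
    ∫ s in a..b, (s - v) = (a - v) * (b - a) + (b - a) ^ 2 / 2 := by
  rw [intervalIntegral.integral_sub (by simp) (by simp)]
  simp
  ring

/-- Under the graph of the age lies one triangle of area xᵢ²/2 per inter-arrival interval. -/
lemma Schedule.Admissible.sum_sq_le_integral_age (hr : r.Admissible x) (hx : ∀ i, 0 < x i) {n : ℕ}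
    {t : ℝ} (ht : arrival x n ≤ t) :
    (∑ i ∈ Finset.range n, x i ^ 2) / 2 ≤ ∫ s in (0 : ℝ)..t, age x r s := by
  have hint := hr.intervalIntegrable_age
  have h0 : 0 ≤ ∫ s in (arrival x n)..t, age x r s :=
    intervalIntegral.integral_nonneg ht fun s hs =>
      hr.age_nonneg ((arrival_nonneg hx n).trans hs.1)
  have h1 := intervalIntegral.sum_integral_adjacent_intervals (f := age x r) (μ := volume)
    (a := arrival x) (n := n) fun k _ => hint _ _
  rw [arrival_zero] at h1
  rw [← intervalIntegral.integral_add_adjacent_intervals (hint 0 (arrival x n)) (hint _ t), ← h1,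
    Finset.sum_div]
  refine le_add_of_le_of_nonneg (Finset.sum_le_sum fun i _ => ?_) h0
  have h2 : x i ^ 2 / 2 = ∫ s in (arrival x i)..(arrival x (i + 1)), (s - arrival x i) := by
    rw [integral_sub_const_eq, arrival_succ]
    ring
  rw [h2]
  exact intervalIntegral.integral_mono_on_of_le_Ioo ((strictMono_arrival hx).monotone i.le_succ)
    ((continuous_id.sub continuous_const).intervalIntegrable _ _) (hint _ _)
    fun s hs => hr.sub_arrival_le_age hx hs.2

/-- The saving on the target age `γ` that is due to a packet generated at time `v`. -/
noncomputable def saving (γ v : ℝ) : ℝ → ℝ := (Set.Icc v (v + γ)).indicator fun s => γ - (s - v)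

lemma saving_nonneg (γ v s : ℝ) : 0 ≤ saving γ v s :=
  Set.indicator_nonneg (fun s hs => by linarith [hs.2]) s

lemma integrable_saving (γ v : ℝ) : Integrable (saving γ v) := by
  have h : Continuous fun s : ℝ => γ - (s - v) := by fun_prop
  exact (h.continuousOn.integrableOn_compact isCompact_Icc).integrable_indicator measurableSet_Icc

lemma integral_saving_le {γ : ℝ} (hγ : 0 ≤ γ) (v : ℝ) {t : ℝ} (ht : 0 ≤ t) :
    ∫ s in (0 : ℝ)..t, saving γ v s ≤ γ ^ 2 / 2 := by
  rw [intervalIntegral.integral_of_le ht]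
  refine (setIntegral_le_integral (integrable_saving γ v)
    (Eventually.of_forall (saving_nonneg γ v))).trans_eq ?_
  unfold saving
  rw [integral_indicator measurableSet_Icc, integral_Icc_eq_integral_Ioc,
    ← intervalIntegral.integral_of_le (by linarith)]
  have : ∀ s : ℝ, γ - (s - v) = -(s - (v + γ)) := fun s => by ring
  simp only [this]
  rw [intervalIntegral.integral_neg, integral_sub_const_eq]
  ring

lemma le_add_saving (γ v s : ℝ) (h : v ≤ s) : γ ≤ (s - v) + saving γ v s := by
  by_cases hs : s ≤ v + γ
  · rw [saving, Set.indicator_of_mem (Set.mem_Icc.2 ⟨h, hs⟩)]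
    linarith
  · linarith [saving_nonneg γ v s]

/-- Each transmission reduces the integral of the age below `γ t` by at most `γ² / 2`. -/
lemma Schedule.Admissible.le_integral_age (hr : r.Admissible x)
    (hT : Tendsto (arrival x) atTop atTop) {γ t : ℝ} (hγ : 0 ≤ γ) (ht : 0 ≤ t) :
    γ * t - (numSent r t + 1) * (γ ^ 2 / 2) ≤ ∫ s in (0 : ℝ)..t, age x r s := by
  have hfin := hr.finite_sent hT t
  set F := hfin.toFinset with hF
  have hcard : numSent r t = F.card := Set.ncard_eq_toFinset_card _ hfin
  have hsav : ∀ v, IntervalIntegrable (saving γ v) volume 0 t := fun v =>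
    (integrable_saving γ v).intervalIntegrable
  have hle : ∀ s ∈ Set.Icc 0 t,
      γ - (saving γ 0 s + ∑ n ∈ F, saving γ (genTime x n) s) ≤ age x r s := by
    intro s hs
    have hsum : 0 ≤ ∑ n ∈ F, saving γ (genTime x n) s :=
      Finset.sum_nonneg fun n _ => saving_nonneg _ _ _
    unfold age
    -- The supremum is attained, so one saving already covers the gap to γ: that of the freshest
    -- received packet, or that of a fictitious packet at time 0. The latter accounts for the `+ 1`
    -- in the bound.
    rcases hr.lastReceived_mem hT s with h | ⟨n, hn, h⟩
    · rw [h]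
      linarith [le_add_saving γ 0 s hs.1]
    · have hnF : n ∈ F := by
        rw [hF, Set.Finite.mem_toFinset]
        exact le_trans hn (WithTop.coe_le_coe.2 hs.2)
      have h1 := Finset.single_le_sum (f := fun n => saving γ (genTime x n) s)
        (fun n _ => saving_nonneg _ _ _) hnF
      rw [← h]
      have h2 := le_add_saving γ _ s (hr.genTime_le hn)
      linarith [saving_nonneg γ 0 s]
  have hIsum : IntervalIntegrable (fun s => ∑ n ∈ F, saving γ (genTime x n) s) volume 0 t :=
    (integrable_finsetSum F fun n _ => integrable_saving γ (genTime x n)).intervalIntegrable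
  have hI : IntervalIntegrable
      (fun s => saving γ 0 s + ∑ n ∈ F, saving γ (genTime x n) s) volume 0 t :=
    (hsav 0).add hIsum
  have hmono := intervalIntegral.integral_mono_on ht (intervalIntegrable_const.sub hI)
    (hr.intervalIntegrable_age 0 t) hle
  refine le_trans ?_ hmono
  rw [intervalIntegral.integral_sub intervalIntegrable_const hI,
    intervalIntegral.integral_add (hsav 0) hIsum,
    intervalIntegral.integral_finsetSum fun n _ => hsav _, intervalIntegral.integral_const]
  have hS : ∑ n ∈ F, ∫ s in (0 : ℝ)..t, saving γ (genTime x n) s ≤ F.card * (γ ^ 2 / 2) := by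
    rw [← nsmul_eq_mul]
    exact Finset.sum_le_card_nsmul _ _ _ fun n _ => integral_saving_le hγ _ ht
  have h0 := integral_saving_le hγ 0 ht
  rw [hcard]
  simp only [sub_zero, smul_eq_mul]
  linarith

lemma avgCost_eq (ρ c t : ℝ) :
    avgCost ρ c x r t = (ρ * c * numSent r t + ∫ s in (0 : ℝ)..t, age x r s) / t := by
  unfold avgCost avgTxCost avgAge
  ring

end Admissible

/-! ### The threshold policy -/

section Threshold

variable {θ : ℝ} {x : ℕ → ℝ}

lemma thresholdPolicy_eq (θ : ℝ) (x : ℕ → ℝ) (n : ℕ) :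
    thresholdPolicy θ x n
      = if θ < elapsed θ x n + x n then (arrival x (n + 1) : WithTop ℝ) else ⊤ := by
  rw [thresholdPolicy, genTime_sub_cycleStart, genTime_eq_arrival]

lemma admissible_thresholdPolicy (θ : ℝ) (x : ℕ → ℝ) : (thresholdPolicy θ x).Admissible x := by
  intro n
  unfold thresholdPolicy
  split_ifs
  · exact le_rfl
  · exact le_top

/-- Packet `m` is generated at `arrival x (m + 1)`, hence the strict inequality `m < n`. -/
lemma thresholdPolicy_le_iff (hx : ∀ i, 0 < x i) {n m : ℕ} {t : ℝ} (h1 : arrival x n ≤ t)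
    (h2 : t < arrival x (n + 1)) :
    thresholdPolicy θ x m ≤ (t : WithTop ℝ) ↔ m < n ∧ θ < elapsed θ x m + x m := by
  have hmono := strictMono_arrival hx
  rw [thresholdPolicy_eq]
  split_ifs with hs
  · rw [WithTop.coe_le_coe]
    simp only [hs, and_true]
    constructor
    · intro h
      have := hmono.lt_iff_lt.1 (h.trans_lt h2)
      lia
    · intro h
      exact (hmono.monotone (show m + 1 ≤ n by lia)).trans h1
  · simp [hs]

lemma cycleStart_succ (θ : ℝ) (x : ℕ → ℝ) (n : ℕ) :
    cycleStart θ x (n + 1)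
      = if θ < elapsed θ x n + x n then genTime x n else cycleStart θ x n := by
  rw [cycleStart, genTime_sub_cycleStart]

lemma cycleStart_mem (θ : ℝ) (x : ℕ → ℝ) (n : ℕ) :
    cycleStart θ x n = 0 ∨
      ∃ m < n, θ < elapsed θ x m + x m ∧ genTime x m = cycleStart θ x n := by
  induction n with
  | zero => exact Or.inl rfl
  | succ n ih =>
    rw [cycleStart_succ]
    split_ifs with hs
    · exact Or.inr ⟨n, n.lt_succ_self, hs, rfl⟩
    · exact ih.imp id fun ⟨m, hm, h⟩ => ⟨m, hm.trans n.lt_succ_self, h⟩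

lemma monotone_cycleStart (hθ : 0 ≤ θ) (x : ℕ → ℝ) : Monotone (cycleStart θ x) :=
  monotone_nat_of_le_succ fun n => by
    rw [cycleStart]
    split_ifs <;> linarith

lemma genTime_le_cycleStart (hθ : 0 ≤ θ) {m n : ℕ} (hmn : m < n)
    (hs : θ < elapsed θ x m + x m) : genTime x m ≤ cycleStart θ x n := by
  have h := monotone_cycleStart hθ x (show m + 1 ≤ n from hmn)
  rwa [cycleStart_succ, if_pos hs] at h

lemma lastReceived_thresholdPolicy (hθ : 0 ≤ θ) (hx : ∀ i, 0 < x i) {n : ℕ} {t : ℝ}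
    (h1 : arrival x n ≤ t) (h2 : t < arrival x (n + 1)) :
    lastReceived x (thresholdPolicy θ x) t = cycleStart θ x n := by
  refine le_antisymm (lastReceived_le (monotone_cycleStart hθ x n.zero_le) fun m hm => ?_) ?_
  · obtain ⟨hmn, hs⟩ := (thresholdPolicy_le_iff hx h1 h2).1 hm
    exact genTime_le_cycleStart hθ hmn hs
  · refine le_csSup ((admissible_thresholdPolicy θ x).bddAbove_received t) ?_
    rcases cycleStart_mem θ x n with h | ⟨m, hmn, hs, h⟩
    · exact Or.inl h
    · exact Or.inr ⟨m, (thresholdPolicy_le_iff hx h1 h2).2 ⟨hmn, hs⟩, h⟩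

/-- Number of packets among the first `n` that the threshold policy transmits. -/
noncomputable def sentCount (θ : ℝ) (x : ℕ → ℝ) (n : ℕ) : ℕ :=
  {m ∈ Finset.range n | θ < elapsed θ x m + x m}.card

lemma numSent_thresholdPolicy (hx : ∀ i, 0 < x i) {n : ℕ} {t : ℝ}
    (h1 : arrival x n ≤ t) (h2 : t < arrival x (n + 1)) :
    numSent (thresholdPolicy θ x) t = sentCount θ x n := by
  rw [numSent, sentCount, ← Set.ncard_coe_finset]
  congr 1
  ext m
  simp [thresholdPolicy_le_iff hx h1 h2]

lemma integral_age_thresholdPolicy_piece (hθ : 0 ≤ θ) (hx : ∀ i, 0 < x i) {n : ℕ} {t : ℝ}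
    (h1 : arrival x n ≤ t) (h2 : t ≤ arrival x (n + 1)) :
    ∫ s in (arrival x n)..t, age x (thresholdPolicy θ x) s
      = elapsed θ x n * (t - arrival x n) + (t - arrival x n) ^ 2 / 2 := by
  rw [elapsed, ← integral_sub_const_eq]
  -- At `s = t = arrival x (n + 1)` packet `n` may just have been received; this single point is
  -- discarded.
  have hae : ∀ᵐ s : ℝ, s ≠ t := by simp [ae_iff]
  refine intervalIntegral.integral_congr_ae ?_
  filter_upwards [hae] with s hst hs
  rw [Set.uIoc_of_le h1] at hs
  rw [age, lastReceived_thresholdPolicy hθ hx hs.1.le ((lt_of_le_of_ne hs.2 hst).trans_le h2)]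

lemma integral_age_thresholdPolicy (hθ : 0 ≤ θ) (hx : ∀ i, 0 < x i) {n : ℕ} {t : ℝ}
    (h1 : arrival x n ≤ t) (h2 : t ≤ arrival x (n + 1)) :
    ∫ s in (0 : ℝ)..t, age x (thresholdPolicy θ x) s
      = ∑ i ∈ Finset.range n, (elapsed θ x i * x i + x i ^ 2 / 2)
        + (elapsed θ x n * (t - arrival x n) + (t - arrival x n) ^ 2 / 2) := by
  have hint := (admissible_thresholdPolicy θ x).intervalIntegrable_age
  have h := intervalIntegral.sum_integral_adjacent_intervals (f := age x (thresholdPolicy θ x))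
    (μ := volume) (a := arrival x) (n := n) fun k _ => hint _ _
  rw [arrival_zero] at h
  rw [← intervalIntegral.integral_add_adjacent_intervals (hint 0 (arrival x n)) (hint _ t), ← h,
    integral_age_thresholdPolicy_piece hθ hx h1 h2]
  congr 1
  refine Finset.sum_congr rfl fun i _ => ?_
  rw [integral_age_thresholdPolicy_piece hθ hx ((strictMono_arrival hx).monotone i.le_succ) le_rfl,
    arrival_succ]
  ring

/-- Decomposition of the cost of the threshold policy into its mean rate `θ + 1 / q`, the deviations,
and a bounded term that depends on the cycle in progress. -/
lemma cost_thresholdPolicy_decomposition (q θ : ℝ) (x : ℕ → ℝ) (n : ℕ) :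
    (θ ^ 2 / 2 + θ / q) * sentCount θ x n
        + ∑ i ∈ Finset.range n, (elapsed θ x i * x i + x i ^ 2 / 2)
      = (θ + 1 / q) * arrival x n + ∑ i ∈ Finset.range n, deviation q θ x i
        - ((θ + 1 / q) * elapsed θ x n - elapsed θ x n ^ 2 / 2) := by
  induction n with
  | zero => simp [sentCount]
  | succ n ih =>
    have hcount : (sentCount θ x (n + 1) : ℝ)
        = sentCount θ x n + if θ < elapsed θ x n + x n then 1 else 0 := by
      unfold sentCount
      rw [Finset.range_add_one, Finset.filter_insert]
      split_ifs
      · rw [Finset.card_insert_of_notMem (by simp)]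
        push_cast
        rfl
      · simp
    rw [Finset.sum_range_succ, Finset.sum_range_succ, arrival_succ, hcount, elapsed_succ, deviation]
    split_ifs with hs
    · rw [max_eq_left (by linarith), overshootCost]
      linear_combination ih
    · rw [max_eq_right (by linarith), overshootCost]
      linear_combination ih

end Threshold

/-! ### Long-run costs -/

/-- Consecutive averages have the same limit, so one term is negligible. This disposes of the
unfinished inter-arrival interval at time t. -/
lemma tendsto_div_of_tendsto_sum_div {a : ℕ → ℝ} {l : ℝ}
    (h : Tendsto (fun n : ℕ => (∑ i ∈ Finset.range n, a i) / (n : ℝ)) atTop (𝓝 l)) :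
    Tendsto (fun n : ℕ => a n / (n : ℝ)) atTop (𝓝 0) := by
  have h1 := h.comp (tendsto_add_atTop_nat 1)
  have hc : Tendsto (fun n : ℕ => ((n : ℝ) + 1) / (n : ℝ)) atTop (𝓝 1) := by
    have h2 := (tendsto_one_div_atTop_nhds_zero_nat (𝕜 := ℝ)).const_add 1
    rw [add_zero] at h2
    refine h2.congr' ?_
    filter_upwards [eventually_gt_atTop 0] with n hn
    have : (0 : ℝ) < n := by exact_mod_cast hn
    field_simp
  have h3 := (h1.mul hc).sub h
  rw [mul_one, sub_self] at h3
  refine h3.congr' ?_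
  filter_upwards [eventually_gt_atTop 0] with n hn
  have : (0 : ℝ) < n := by exact_mod_cast hn
  simp only [Function.comp_apply, Finset.sum_range_succ]
  push_cast
  field_simp
  ring

lemma tendsto_arrival_atTop {x : ℕ → ℝ} {q : ℝ} (hq : 0 < q)
    (h : Tendsto (fun n : ℕ => arrival x n / (n : ℝ)) atTop (𝓝 (1 / q))) :
    Tendsto (arrival x) atTop atTop := by
  have h1 := h.pos_mul_atTop (by positivity) (tendsto_natCast_atTop_atTop (R := ℝ))
  refine h1.congr' ?_
  filter_upwards [eventually_gt_atTop 0] with n hn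
  have : (0 : ℝ) < n := by exact_mod_cast hn
  field_simp

lemma ofReal_le_longRunCost {ρ c l : ℝ} {x : ℕ → ℝ} {r : Schedule} {g : ℝ → ℝ}
    (hg : Tendsto g atTop (𝓝 l)) (h : ∀ᶠ t in atTop, g t ≤ avgCost ρ c x r t) :
    ENNReal.ofReal l ≤ longRunCost ρ c x r := by
  rw [← (ENNReal.tendsto_ofReal hg).liminf_eq]
  exact liminf_le_liminf (h.mono fun t ht => ENNReal.ofReal_le_ofReal ht)

section LongRun

variable {q ρ c : ℝ} {x : ℕ → ℝ} {r : Schedule}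

lemma sqrt_le_longRunCost (hr : r.Admissible x) (hT : Tendsto (arrival x) atTop atTop)
    (hβ : 0 ≤ ρ * c) : ENNReal.ofReal (√(2 * (ρ * c))) ≤ longRunCost ρ c x r := by
  have hlim : Tendsto (fun t : ℝ => √(2 * (ρ * c)) - ρ * c / t) atTop (𝓝 (√(2 * (ρ * c)))) := by
    have := (tendsto_const_nhds (x := ρ * c)).div_atTop tendsto_id
    simpa using this.const_sub (√(2 * (ρ * c)))
  refine ofReal_le_longRunCost hlim ?_
  filter_upwards [eventually_gt_atTop 0] with t ht
  have h := hr.le_integral_age hT (Real.sqrt_nonneg (2 * (ρ * c))) ht.le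
  rw [Real.sq_sqrt (by positivity)] at h
  rw [avgCost_eq, le_div_iff₀ ht, sub_mul, div_mul_cancel₀ _ ht.ne']
  linarith

lemma inv_le_longRunCost (hr : r.Admissible x) (hx : ∀ i, 0 < x i) (hq : 0 < q)
    (h1 : Tendsto (fun n : ℕ => arrival x n / (n : ℝ)) atTop (𝓝 (1 / q)))
    (h2 : Tendsto (fun n : ℕ => (∑ i ∈ Finset.range n, x i ^ 2) / (n : ℝ)) atTop (𝓝 (2 / q ^ 2)))
    (hβ : 0 ≤ ρ * c) : ENNReal.ofReal (1 / q) ≤ longRunCost ρ c x r := by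
  obtain ⟨N, hN, hNlim⟩ := exists_arrivalCount hx (tendsto_arrival_atTop hq h1)
  -- The index `n + 1` is needed because `t` is bounded above only by the next arrival.
  have hlim : Tendsto (fun n : ℕ => (∑ i ∈ Finset.range n, x i ^ 2) / 2 / arrival x (n + 1)) atTop
      (𝓝 (1 / q)) := by
    have h3 := (h2.div_const 2).div (h1.add (tendsto_div_of_tendsto_sum_div h1))
      (by positivity)
    have e : 2 / q ^ 2 / 2 / (1 / q + 0) = 1 / q := by field_simp; simp
    rw [e] at h3
    refine h3.congr' ?_
    filter_upwards [eventually_gt_atTop 0] with n hn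
    have hn' : (0 : ℝ) < n := by exact_mod_cast hn
    have hpos : 0 < arrival x n + x n := by linarith [arrival_nonneg hx n, hx n]
    rw [arrival_succ]
    simp only [Pi.div_apply, ← add_div]
    field_simp
  refine ofReal_le_longRunCost (hlim.comp hNlim) ?_
  filter_upwards [eventually_gt_atTop 0] with t ht
  obtain ⟨hle, hlt⟩ := hN t ht.le
  rw [avgCost_eq, Function.comp_apply]
  have hs : 0 ≤ ∑ i ∈ Finset.range (N t), x i ^ 2 := Finset.sum_nonneg fun i _ => sq_nonneg _
  have hi := hr.sum_sq_le_integral_age hx hle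
  have hR : 0 ≤ ρ * c * numSent r t := by positivity
  exact div_le_div₀ (by linarith) (by linarith) ht hlt.le

lemma tendsto_avgCost_thresholdPolicy {θ : ℝ} (hq : 0 < q) (hθ : 0 ≤ θ)
    (hβ : ρ * c = θ ^ 2 / 2 + θ / q) (hx : ∀ i, 0 < x i)
    (h1 : Tendsto (fun n : ℕ => arrival x n / (n : ℝ)) atTop (𝓝 (1 / q)))
    (h2 : Tendsto (fun n : ℕ => (∑ i ∈ Finset.range n, x i ^ 2) / (n : ℝ)) atTop (𝓝 (2 / q ^ 2)))
    (hD : Tendsto (fun n : ℕ => (∑ i ∈ Finset.range n, deviation q θ x i) / (n : ℝ)) atTop (𝓝 0)) :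
    Tendsto (avgCost ρ c x (thresholdPolicy θ x)) atTop (𝓝 (θ + 1 / q)) := by
  obtain ⟨N, hN, hNlim⟩ := exists_arrivalCount hx (tendsto_arrival_atTop hq h1)
  set S := θ + 1 / q with hS
  have hS0 : 0 < S := by positivity
  have hθS : θ ≤ S := by
    have : 0 < 1 / q := by positivity
    linarith
  -- `E` bounds the error in the accumulated cost at any time between arrivals `n` and `n + 1`: the
  -- deviations, the cycle term of the decomposition, and the cost and mean rate over the incomplete
  -- interval.
  set E : ℕ → ℝ := fun n =>
    |∑ i ∈ Finset.range n, deviation q θ x i| + S * θ + ((θ + S) * x n + x n ^ 2 / 2) with hE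
  have hElim : Tendsto (fun n => E n / arrival x n) atTop (𝓝 0) := by
    have hx1 := tendsto_div_of_tendsto_sum_div h1
    have hx2 := tendsto_div_of_tendsto_sum_div h2
    have hc := tendsto_const_div_atTop_nhds_zero_nat (S * θ)
    have hsum := ((hD.abs.add hc).add ((hx1.const_mul (θ + S)).add (hx2.div_const 2))).div h1
      (by positivity)
    simp only [abs_zero, zero_add, mul_zero, zero_div] at hsum
    refine hsum.congr' ?_
    filter_upwards [eventually_gt_atTop 0] with n hn
    have hn' : (0 : ℝ) < n := by exact_mod_cast hn
    have hpos : 0 < arrival x n := by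
      simpa using strictMono_arrival hx hn
    simp only [Pi.div_apply, hE]
    rw [abs_div, abs_of_pos hn']
    field_simp
  rw [tendsto_iff_norm_sub_tendsto_zero]
  refine squeeze_zero' (Eventually.of_forall fun t => norm_nonneg _) ?_ (hElim.comp hNlim)
  filter_upwards [eventually_gt_atTop 0, hNlim.eventually_gt_atTop 0] with t ht hNt
  obtain ⟨hle, hlt⟩ := hN t ht.le
  have hpos : 0 < arrival x (N t) := by simpa using strictMono_arrival hx hNt
  rw [Function.comp_apply, Real.norm_eq_abs, avgCost_eq, numSent_thresholdPolicy hx hle hlt,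
    integral_age_thresholdPolicy hθ hx hle hlt.le, div_sub' ht.ne', abs_div, abs_of_pos ht]
  refine div_le_div₀ (by positivity [hx (N t)]) ?_ hpos hle
  set n := N t
  have hdec := cost_thresholdPolicy_decomposition q θ x n
  rw [← hβ, ← hS] at hdec
  set y := t - arrival x n with hy
  have hy0 : 0 ≤ y := sub_nonneg.2 hle
  have hyx : y ≤ x n := by rw [arrival_succ] at hlt; linarith
  have he0 := elapsed_nonneg θ hx n
  have heθ := elapsed_le hθ x n
  set e := elapsed θ x n
  set M := ∑ i ∈ Finset.range n, deviation q θ x i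
  have hty : t = arrival x n + y := by ring
  have hey0 : 0 ≤ e * y := by positivity
  have heyx : e * y ≤ θ * x n := by gcongr
  have hy2 : y ^ 2 ≤ x n ^ 2 := by gcongr
  have hSy : S * y ≤ S * x n := by gcongr
  have hSe : S * e ≤ S * θ := by gcongr
  have hee : e ^ 2 ≤ S * e := by nlinarith
  have hSy0 : 0 ≤ S * y := by positivity
  have hM1 := le_abs_self M
  have hM2 := neg_abs_le M
  have hxn := hx n
  have hθx : 0 ≤ θ * x n := by positivity
  have hSθ : 0 ≤ S * θ := by positivity
  simp only [hE]
  rw [abs_le]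
  constructor <;> nlinarith [sq_nonneg y, sq_nonneg e, sq_nonneg (x n)]

end LongRun

/-! ### The competitive ratio -/

section Ratio

variable {q ρ c : ℝ}

lemma optThreshold_nonneg (hρ : 0 ≤ ρ) (hc : 0 ≤ c) : 0 ≤ optThreshold q ρ c := by
  have : 0 ≤ ρ * c := by positivity
  refine sub_nonneg.2 (Real.le_sqrt_of_sq_le ?_)
  rw [div_pow, one_pow]
  linarith

/-- The threshold is a root of this quadratic, precisely the price at which the cost decomposition
has no drift besides θ + 1/q. -/
lemma mul_eq_optThreshold (hρ : 0 ≤ ρ) (hc : 0 ≤ c) :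
    ρ * c = optThreshold q ρ c ^ 2 / 2 + optThreshold q ρ c / q := by
  have h := Real.sq_sqrt (show 0 ≤ 1 / q ^ 2 + 2 * (ρ * c) by positivity)
  unfold optThreshold
  linear_combination -h / 2

lemma ae_costs (hq : 0 < q) (hρ : 0 ≤ ρ) (hc : 0 ≤ c) :
    ∀ᵐ x ∂(poissonInput q),
      Tendsto (avgCost ρ c x (onlinePolicy q ρ c x)) atTop (𝓝 (√(1 / q ^ 2 + 2 * (ρ * c)))) ∧
      ENNReal.ofReal (1 / q) ≤ offlineCost ρ c x ∧
      ENNReal.ofReal (√(2 * (ρ * c))) ≤ offlineCost ρ c x := by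
  have hβ : 0 ≤ ρ * c := by positivity
  have hθ := optThreshold_nonneg (q := q) hρ hc
  filter_upwards [poissonInput_ae_pos hq, poissonInput_ae_tendsto_sum_pow hq 1,
    poissonInput_ae_tendsto_sum_pow hq 2, poissonInput_ae_tendsto_sum_deviation hq hθ]
    with x hx h1 h2 hD
  have h1' : Tendsto (fun n : ℕ => arrival x n / (n : ℝ)) atTop (𝓝 (1 / q)) := by
    simpa [arrival] using h1
  have h2' : Tendsto (fun n : ℕ => (∑ i ∈ Finset.range n, x i ^ 2) / (n : ℝ)) atTop
      (𝓝 (2 / q ^ 2)) := by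
    simpa using h2
  refine ⟨?_, le_iInf₂ fun r hr => inv_le_longRunCost hr hx hq h1' h2' hβ,
    le_iInf₂ fun r hr => sqrt_le_longRunCost hr (tendsto_arrival_atTop hq h1') hβ⟩
  have h := tendsto_avgCost_thresholdPolicy hq hθ (mul_eq_optThreshold hρ hc) hx h1' h2' hD
  rwa [optThreshold, sub_add_cancel] at h

lemma competitiveRatio_le_of_le {l : ℝ} (hq : 0 < q) (hρ : 0 ≤ ρ) (hc : 0 ≤ c) (hl : 0 < l)
    (h : ∀ᵐ x ∂(poissonInput q), ENNReal.ofReal l ≤ offlineCost ρ c x) :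
    competitiveRatio (poissonInput q) ρ c (onlinePolicy q ρ c)
      ≤ ENNReal.ofReal (√(1 / q ^ 2 + 2 * (ρ * c)) / l) := by
  refine essSup_le_of_ae_le _ ?_
  filter_upwards [ae_costs hq hρ hc, h] with x hx hlx
  rw [longRunCost, (ENNReal.tendsto_ofReal hx.1).liminf_eq, ENNReal.ofReal_div_of_pos hl]
  exact ENNReal.div_le_div_left hlx _

/-- The online schedule competes in the offline infimum. The offline cost must be shown positive and
finite so that the `ℝ≥0∞` quotient is not degenerate. -/
lemma one_le_competitiveRatio (hq : 0 < q) (hρ : 0 ≤ ρ) (hc : 0 ≤ c) :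
    1 ≤ competitiveRatio (poissonInput q) ρ c (onlinePolicy q ρ c) := by
  have := isProbabilityMeasure_poissonInput hq
  rw [← essSup_const (μ := poissonInput q) (1 : ℝ≥0∞) (IsProbabilityMeasure.ne_zero _)]
  refine essSup_mono_ae ?_
  filter_upwards [ae_costs hq hρ hc] with x hx
  have hle : offlineCost ρ c x ≤ longRunCost ρ c x (onlinePolicy q ρ c x) :=
    iInf₂_le _ (admissible_thresholdPolicy _ _)
  have hpos : offlineCost ρ c x ≠ 0 :=
    ((ENNReal.ofReal_pos.2 (by positivity)).trans_le hx.2.1).ne'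
  have hfin : offlineCost ρ c x ≠ ⊤ := by
    refine ne_top_of_le_ne_top ?_ hle
    rw [longRunCost, (ENNReal.tendsto_ofReal hx.1).liminf_eq]
    exact ENNReal.ofReal_ne_top
  rwa [ENNReal.le_div_iff_mul_le (Or.inl hpos) (Or.inl hfin), one_mul]

lemma competitiveRatio_le_sqrt_two (hq : 0 < q) (hρ : 0 ≤ ρ) (hc : 0 ≤ c) :
    competitiveRatio (poissonInput q) ρ c (onlinePolicy q ρ c) ≤ ENNReal.ofReal (√2) := by
  -- Each of the two squares under the root in the online cost is at most l².
  set l := max (1 / q) (√(2 * (ρ * c))) with hl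
  have hβ : 0 ≤ 2 * (ρ * c) := by positivity
  have hq' : 0 < 1 / q := by positivity
  have hl0 : 0 < l := hq'.trans_le (le_max_left _ _)
  refine (competitiveRatio_le_of_le hq hρ hc hl0 ?_).trans (ENNReal.ofReal_le_ofReal ?_)
  · filter_upwards [ae_costs hq hρ hc] with x hx
    rw [hl, ENNReal.ofReal_max]
    exact max_le hx.2.1 hx.2.2
  · rw [div_le_iff₀ hl0, ← Real.sqrt_sq hl0.le, ← Real.sqrt_mul zero_le_two]
    refine Real.sqrt_le_sqrt ?_
    have h1 : (1 / q) ^ 2 ≤ l ^ 2 := by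
      gcongr
      exact le_max_left _ _
    have h2 : √(2 * (ρ * c)) ^ 2 ≤ l ^ 2 := by
      gcongr
      exact le_max_right _ _
    rw [Real.sq_sqrt hβ] at h2
    rw [div_pow, one_pow] at h1
    linarith

lemma competitiveRatio_le_of_pos (hq : 0 < q) (hρ : 0 ≤ ρ) (hc : 0 ≤ c)
    (hpos : 0 < q ^ 2 * ρ * c) :
    competitiveRatio (poissonInput q) ρ c (onlinePolicy q ρ c)
      ≤ ENNReal.ofReal (√(1 + 1 / (2 * (q ^ 2 * ρ * c)))) := by
  have hβ : 0 < ρ * c := by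
    rw [mul_assoc] at hpos
    exact (pos_iff_pos_of_mul_pos hpos).1 (by positivity)
  have hρ' : ρ ≠ 0 := left_ne_zero_of_mul hβ.ne'
  have hc' : c ≠ 0 := right_ne_zero_of_mul hβ.ne'
  refine (competitiveRatio_le_of_le hq hρ hc (Real.sqrt_pos.2 (by positivity : 0 < 2 * (ρ * c)))
    ((ae_costs hq hρ hc).mono fun x hx => hx.2.2)).trans_eq ?_
  rw [← Real.sqrt_div (by positivity)]
  congr 2
  field_simp
  ring

end Ratio

end AgeInfo

theorem mainTheorem3 :
    -- the ratio is well defined: the cost of the online policy is a genuine finite limit, and the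
    -- optimal offline cost is positive
    (∀ q ρ c : ℝ, 0 < q → 0 ≤ ρ → 0 ≤ c →
      ∀ᵐ x ∂(AgeInfo.poissonInput q),
        (∃ Γ : ℝ, Tendsto (AgeInfo.avgCost ρ c x (AgeInfo.onlinePolicy q ρ c x)) atTop (𝓝 Γ)) ∧
        0 < AgeInfo.offlineCost ρ c x) ∧
    (∀ q ρ c : ℝ, 0 < q → 0 ≤ ρ → 0 ≤ c →
      AgeInfo.competitiveRatio (AgeInfo.poissonInput q) ρ c (AgeInfo.onlinePolicy q ρ c) ≤
        ENNReal.ofReal (√2)) ∧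
    Tendsto
      (fun p : ℝ × ℝ × ℝ =>
        AgeInfo.competitiveRatio (AgeInfo.poissonInput p.1) p.2.1 p.2.2
          (AgeInfo.onlinePolicy p.1 p.2.1 p.2.2))
      (comap (fun p : ℝ × ℝ × ℝ => p.1 ^ 2 * p.2.1 * p.2.2) atTop ⊓
        𝓟 {p : ℝ × ℝ × ℝ | 0 < p.1 ∧ 0 ≤ p.2.1 ∧ 0 ≤ p.2.2})
      (𝓝 1) := by
  refine ⟨fun q ρ c hq hρ hc => ?_, fun q ρ c hq hρ hc =>
    AgeInfo.competitiveRatio_le_sqrt_two hq hρ hc, ?_⟩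
  · filter_upwards [AgeInfo.ae_costs hq hρ hc] with x hx
    exact ⟨⟨_, hx.1⟩, (ENNReal.ofReal_pos.2 (by positivity)).trans_le hx.2.1⟩
  · set F := comap (fun p : ℝ × ℝ × ℝ => p.1 ^ 2 * p.2.1 * p.2.2) atTop ⊓
        𝓟 {p : ℝ × ℝ × ℝ | 0 < p.1 ∧ 0 ≤ p.2.1 ∧ 0 ≤ p.2.2}
    have hF : Tendsto (fun p : ℝ × ℝ × ℝ => p.1 ^ 2 * p.2.1 * p.2.2) F atTop :=
      tendsto_comap.mono_left inf_le_left
    have hdom : ∀ᶠ p in F, 0 < p.1 ∧ 0 ≤ p.2.1 ∧ 0 ≤ p.2.2 :=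
      (eventually_principal.2 fun _ hp => hp).filter_mono inf_le_right
    have hbound : Tendsto (fun u : ℝ => ENNReal.ofReal (√(1 + 1 / (2 * u)))) atTop (𝓝 1) := by
      have h1 : Tendsto (fun u : ℝ => 1 + 1 / (2 * u)) atTop (𝓝 1) := by
        have := (tendsto_const_nhds (x := (1 : ℝ))).div_atTop
          (tendsto_id.const_mul_atTop (two_pos (α := ℝ)))
        simpa using this.const_add 1
      simpa using ENNReal.tendsto_ofReal h1.sqrt
    -- The upper bound depends on the parameters only through q²ρc, which gives the uniformity.
    refine tendsto_of_tendsto_of_tendsto_of_le_of_le' tendsto_const_nhds (hbound.comp hF) ?_ ?_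
    · filter_upwards [hdom] with p hp
      exact AgeInfo.one_le_competitiveRatio hp.1 hp.2.1 hp.2.2
    · filter_upwards [hdom, hF.eventually_gt_atTop 0] with p hp hpos
      exact AgeInfo.competitiveRatio_le_of_pos hp.1 hp.2.1 hp.2.2 hpos
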